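/- A *pseudo-Kleene lattice* is an algebra $\mathbf A=(A,\wedge,\vee,{}',0,1)$ such that $(A,\wedge,\vee,0,1)$ is a bounded lattice, $'$ is an antitone involution ($x\le y$ implies $y'\le x'$, and $x''=x$), and $x\wedge x'\le y\vee y'$ for all $x,y\in A$. It is *sp-orthomodular* (super-paraorthomodular) if for all $x\le y$ in $A$: (SP1) if $x'\wedge y=(x\wedge x')\vee(y\wedge y')$, then $y\wedge(x\vee x')=x\vee(y\wedge y')$; (SP2) $(x\wedge x')\vee(y\wedge y')=(x'\wedge y)\wedge(x'\wedge y)'$. Subalgebras, congruences, quotients, homomorphisms and isomorphisms refer to the signature $(\wedge,\vee,{}',0,1)$. Consider the following four finite pseudo-Kleene lattices, given by their covering relations, in which $'$ exchanges $0$ with $1$ and each named element $a$ with $a'$: * $\mathbf B_6=\{0,x,y,x',y',1\}$: $0<x<y<1$ and $0<y'<x'<1$. * $\mathbf B_8=\{0,z',x,y,x',y',z,1\}$: $0<z'$, $z'<x<y<z$, $z'<y'<x'<z$, $z<1$. * $\mathbf B_8^*=\{0,x,y,z,x',y',z',1\}$: $0<x<z<y'<1$, $0<y<z'<x'<1$ and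 $z<z'$. * $\mathbf B_{10}=\{0,x,y,w,m,x',y',w',m',1\}$: $0<y'$, $0<w$, $0<x$, $y'<m$, $w<m$, $w<m'$, $x<m'$, $m<x'$, $m<w'$, $m'<w'$, $m'<y$, $x'<1$, $w'<1$, $y<1$. **Theorem.** 1. A pseudo-Kleene lattice $\mathbf A$ is sp-orthomodular if and only if it has no subalgebra $\mathbf B$ such that $\mathbf B\cong\mathbf B_6$, or $\mathbf B\cong\mathbf B_8$, or, for some congruence $\theta$ of $\mathbf B$, $\mathbf B/\theta\cong\mathbf B_8^*$ or $\mathbf B/\theta\cong\mathbf B_{10}$. 2. A pseudo-Kleene lattice $\mathbf A$ is sp-orthomodular if and only if it has no subalgebra $\mathbf B$ such that, for some congruence $\theta$ of $\mathbf B$, $\mathbf B/\theta$ is isomorphic to $\mathbf B_6$, $\mathbf B_8^*$ or $\mathbf B_{10}$. 3. Let $\mathcal V$ be a subvariety of the variety of pseudo-Kleene lattices (a class of pseudo-Kleene lattices closed under homomorphic images, subalgebras and direct products). Then every member of $\mathcal V$ is sp-orthomodular if and only if $\mathcal V$ contains no member isomorphic to $\mathbf B_6$, $\mathbf B_8^*$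 or $\mathbf B_{10}$. -/

import Mathlib

universe u v

/-- A pseudo-Kleene lattice: a bounded lattice with an antitone involution `ᶜ` satisfying the
Kleene condition `a ⊓ aᶜ ≤ b ⊔ bᶜ`. -/
class PKLattice (A : Type u) extends Lattice A, BoundedOrder A, Compl A where
  compl_antitone : ∀ a b : A, a ≤ b → bᶜ ≤ aᶜ
  compl_invol : ∀ a : A, aᶜᶜ = a
  kleene : ∀ a b : A, a ⊓ aᶜ ≤ b ⊔ bᶜ

namespace PKLattice

variable {A : Type u} [PKLattice A]

theorem compl_sup_eq (a b : A) : (a ⊔ b)ᶜ = aᶜ ⊓ bᶜ := by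
  apply le_antisymm
  · exact le_inf (compl_antitone _ _ le_sup_left) (compl_antitone _ _ le_sup_right)
  · rw [← compl_invol (aᶜ ⊓ bᶜ)]
    apply compl_antitone
    apply sup_le
    · conv_lhs => rw [← compl_invol a]
      exact compl_antitone _ _ inf_le_left
    · conv_lhs => rw [← compl_invol b]
      exact compl_antitone _ _ inf_le_right

theorem compl_inf_eq (a b : A) : (a ⊓ b)ᶜ = aᶜ ⊔ bᶜ := by
  rw [← compl_invol (aᶜ ⊔ bᶜ), compl_sup_eq, compl_invol, compl_invol]

end PKLattice

/-- Super-paraorthomodular pseudo-Kleene lattices. -/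
structure IsSPOrthomodular (A : Type u) [PKLattice A] : Prop where
  sp1 : ∀ x y : A, x ≤ y → xᶜ ⊓ y = (x ⊓ xᶜ) ⊔ (y ⊓ yᶜ) → y ⊓ (x ⊔ xᶜ) = x ⊔ (y ⊓ yᶜ)
  sp2 : ∀ x y : A, x ≤ y → (x ⊓ xᶜ) ⊔ (y ⊓ yᶜ) = (xᶜ ⊓ y) ⊓ (xᶜ ⊓ y)ᶜ

/-- Isomorphism of pseudo-Kleene lattices: an order isomorphism (which then preserves the lattice
operations and the bounds) that commutes with the involution. -/
def PKIso (A : Type u) (B : Type v) [PKLattice A] [PKLattice B] : Prop :=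
  ∃ e : A ≃o B, ∀ a : A, e aᶜ = (e a)ᶜ

/-- Homomorphisms in the signature `(⊓, ⊔, ᶜ, ⊥, ⊤)`. -/
structure IsPKHom {A : Type u} {B : Type v} [PKLattice A] [PKLattice B] (f : A → B) : Prop where
  map_inf : ∀ a b, f (a ⊓ b) = f a ⊓ f b
  map_sup : ∀ a b, f (a ⊔ b) = f a ⊔ f b
  map_compl : ∀ a, f aᶜ = (f a)ᶜ
  map_bot : f ⊥ = ⊥
  map_top : f ⊤ = ⊤

/-- Subalgebras in the signature `(⊓, ⊔, ᶜ, ⊥, ⊤)`. -/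
structure PKSubalgebra (A : Type u) [PKLattice A] extends Sublattice A where
  bot_mem' : ⊥ ∈ carrier
  top_mem' : ⊤ ∈ carrier
  compl_mem' : ∀ a ∈ carrier, aᶜ ∈ carrier

namespace PKSubalgebra

variable {A : Type u} [PKLattice A]

instance : CoeSort (PKSubalgebra A) (Type u) := ⟨fun B => ↥B.toSublattice⟩

/-- A subalgebra with the restricted operations. -/
instance (B : PKSubalgebra A) : PKLattice ↥B.toSublattice where
  top := ⟨⊤, B.top_mem'⟩
  le_top a := (le_top : (a : A) ≤ ⊤)
  bot := ⟨⊥, B.bot_mem'⟩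
  bot_le a := (bot_le : ⊥ ≤ (a : A))
  compl a := ⟨(a : A)ᶜ, B.compl_mem' a a.2⟩
  compl_antitone a b h := PKLattice.compl_antitone (a : A) b h
  compl_invol a := Subtype.ext (PKLattice.compl_invol (a : A))
  kleene a b := PKLattice.kleene (a : A) b

end PKSubalgebra

/-- Congruences in the signature `(⊓, ⊔, ᶜ, ⊥, ⊤)`. -/
structure PKCon (A : Type u) [PKLattice A] extends LatticeCon A where
  compl : ∀ {a b : A}, r a b → r aᶜ bᶜ

namespace PKCon

variable {A : Type u} [PKLattice A]

/-- The underlying type of the quotient algebra. -/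
def Quo (θ : PKCon A) : Type u := Quotient θ.toSetoid

/-- The class of an element. -/
def toQuo (θ : PKCon A) (a : A) : θ.Quo := Quotient.mk θ.toSetoid a

instance (θ : PKCon A) : Max θ.Quo :=
  ⟨Quotient.map₂ (· ⊔ ·) fun _ _ h _ _ k => θ.sup h k⟩

instance (θ : PKCon A) : Min θ.Quo :=
  ⟨Quotient.map₂ (· ⊓ ·) fun _ _ h _ _ k => θ.inf h k⟩

instance (θ : PKCon A) : Lattice θ.Quo :=
  Lattice.mk'
    (by rintro ⟨a⟩ ⟨b⟩; exact congrArg θ.toQuo (sup_comm a b))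
    (by rintro ⟨a⟩ ⟨b⟩ ⟨c⟩; exact congrArg θ.toQuo (sup_assoc a b c))
    (by rintro ⟨a⟩ ⟨b⟩; exact congrArg θ.toQuo (inf_comm a b))
    (by rintro ⟨a⟩ ⟨b⟩ ⟨c⟩; exact congrArg θ.toQuo (inf_assoc a b c))
    (by rintro ⟨a⟩ ⟨b⟩; exact congrArg θ.toQuo (sup_inf_self (a := a) (b := b)))
    (by rintro ⟨a⟩ ⟨b⟩; exact congrArg θ.toQuo (inf_sup_self (a := a) (b := b)))

theorem toQuo_le_toQuo (θ : PKCon A) {a b : A} (h : a ≤ b) :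
    θ.toQuo a ≤ θ.toQuo b :=
  sup_eq_right.mp (congrArg θ.toQuo (sup_eq_right.mpr h))

/-- The quotient algebra, with the operations induced on classes. -/
instance (θ : PKCon A) : PKLattice θ.Quo where
  top := θ.toQuo ⊤
  le_top := by rintro ⟨a⟩; exact θ.toQuo_le_toQuo le_top
  bot := θ.toQuo ⊥
  bot_le := by rintro ⟨a⟩; exact θ.toQuo_le_toQuo bot_le
  compl := Quotient.map (fun a => aᶜ) fun _ _ h => θ.compl h
  compl_antitone := by
    rintro ⟨a⟩ ⟨b⟩ h
    have h1 : θ.toQuo (a ⊔ b) = θ.toQuo b :=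
      sup_eq_right.mpr h
    have h2 : θ.r (a ⊔ b)ᶜ bᶜ := θ.compl (Quotient.exact h1)
    have h3 : θ.toQuo (a ⊔ b)ᶜ = θ.toQuo bᶜ :=
      Quotient.sound h2
    exact h3.symm.le.trans (θ.toQuo_le_toQuo (PKLattice.compl_antitone _ _ le_sup_left))
  compl_invol := by
    rintro ⟨a⟩; exact congrArg θ.toQuo (PKLattice.compl_invol a)
  kleene := by rintro ⟨a⟩ ⟨b⟩; exact θ.toQuo_le_toQuo (PKLattice.kleene a b)

end PKCon

/-- Direct products, with the pointwise operations. -/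
instance {ι : Type v} (A : ι → Type u) [∀ i, PKLattice (A i)] : PKLattice (∀ i, A i) where
  compl a i := (a i)ᶜ
  compl_antitone a b h i := PKLattice.compl_antitone (a i) (b i) (h i)
  compl_invol a := funext fun i => PKLattice.compl_invol (a i)
  kleene a b i := PKLattice.kleene (a i) (b i)

/-- A subvariety of the variety of pseudo-Kleene lattices: a class of pseudo-Kleene lattices closed
under homomorphic images (in particular isomorphic copies), subalgebras and direct products. -/
structure IsPKVariety (V : ∀ A : Type u, PKLattice A → Prop) : Prop where
  hom_image : ∀ (A B : Type u) [iA : PKLattice A] [iB : PKLattice B] (f : A → B),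
    IsPKHom f → Function.Surjective f → V A iA → V B iB
  subalgebra : ∀ (A : Type u) [iA : PKLattice A] (B : PKSubalgebra A),
    V A iA → V B inferInstance
  prod : ∀ (ι : Type u) (A : ι → Type u) [iA : ∀ i, PKLattice (A i)],
    (∀ i, V (A i) (iA i)) → V (∀ i, A i) inferInstance

/-- The six-element lattice (benzene ring) with covers
`0 < x < y < 1` and `0 < y' < x' < 1`.
In the constructor names a final `c` stands for the prime. -/
inductive PKB6 : Type
  | zero | x | yc | y | xc | one
  deriving DecidableEq

namespace PKB6

/-- The elements, listed along a linear extension of the order. -/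
def elems : List PKB6 := [.zero, .x, .yc, .y, .xc, .one]

instance : Fintype PKB6 := ⟨⟨elems, by decide⟩, fun a => by cases a <;> decide⟩

/-- `up a` lists the elements `b` with `a ≤ b`. -/
def up : PKB6 → List PKB6
  | .zero => elems
  | .x => [.x, .y, .one]
  | .yc => [.yc, .xc, .one]
  | .y => [.y, .one]
  | .xc => [.xc, .one]
  | .one => [.one]

/-- The involution. -/
def inv : PKB6 → PKB6
  | .zero => .one
  | .x => .xc
  | .yc => .y
  | .y => .yc
  | .xc => .x
  | .one => .zero

instance : PKLattice PKB6 where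
  le a b := b ∈ up a
  le_refl := by decide
  le_trans := by decide
  le_antisymm := by decide
  sup a b := (elems.find? fun c => c ∈ up a ∧ c ∈ up b).getD .one
  le_sup_left := by decide
  le_sup_right := by decide
  sup_le := by decide
  inf a b := (elems.reverse.find? fun c => a ∈ up c ∧ b ∈ up c).getD .zero
  inf_le_left := by decide
  inf_le_right := by decide
  le_inf := by decide
  top := .one
  le_top := by decide
  bot := .zero
  bot_le := by decide
  compl := inv
  compl_antitone := by decide
  compl_invol := by decide
  kleene := by decide

end PKB6

/-- The eight-element lattice with covers `0 < z'`, `z' < x < y < z`, `z' < y' < x' < z`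
and `z < 1`.
In the constructor names a final `c` stands for the prime. -/
inductive PKB8 : Type
  | zero | zc | x | yc | y | xc | z | one
  deriving DecidableEq

namespace PKB8

/-- The elements, listed along a linear extension of the order. -/
def elems : List PKB8 := [.zero, .zc, .x, .yc, .y, .xc, .z, .one]

instance : Fintype PKB8 := ⟨⟨elems, by decide⟩, fun a => by cases a <;> decide⟩

/-- `up a` lists the elements `b` with `a ≤ b`. -/
def up : PKB8 → List PKB8
  | .zero => elems
  | .zc => [.zc, .x, .yc, .y, .xc, .z, .one]
  | .x => [.x, .y, .z, .one]
  | .yc => [.yc, .xc, .z, .one]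
  | .y => [.y, .z, .one]
  | .xc => [.xc, .z, .one]
  | .z => [.z, .one]
  | .one => [.one]

/-- The involution. -/
def inv : PKB8 → PKB8
  | .zero => .one
  | .zc => .z
  | .x => .xc
  | .yc => .y
  | .y => .yc
  | .xc => .x
  | .z => .zc
  | .one => .zero

instance : PKLattice PKB8 where
  le a b := b ∈ up a
  le_refl := by decide
  le_trans := by decide
  le_antisymm := by decide
  sup a b := (elems.find? fun c => c ∈ up a ∧ c ∈ up b).getD .one
  le_sup_left := by decide
  le_sup_right := by decide
  sup_le := by decide
  inf a b := (elems.reverse.find? fun c => a ∈ up c ∧ b ∈ up c).getD .zero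
  inf_le_left := by decide
  inf_le_right := by decide
  le_inf := by decide
  top := .one
  le_top := by decide
  bot := .zero
  bot_le := by decide
  compl := inv
  compl_antitone := by decide
  compl_invol := by decide
  kleene := by decide

end PKB8

/-- The eight-element lattice with covers `0 < x < z < y' < 1`, `0 < y < z' < x' < 1`
and `z < z'`.
In the constructor names a final `c` stands for the prime. -/
inductive PKB8Star : Type
  | zero | x | y | z | zc | yc | xc | one
  deriving DecidableEq

namespace PKB8Star

/-- The elements, listed along a linear extension of the order. -/
def elems : List PKB8Star := [.zero, .x, .y, .z, .zc, .yc, .xc, .one]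

instance : Fintype PKB8Star := ⟨⟨elems, by decide⟩, fun a => by cases a <;> decide⟩

/-- `up a` lists the elements `b` with `a ≤ b`. -/
def up : PKB8Star → List PKB8Star
  | .zero => elems
  | .x => [.x, .z, .zc, .yc, .xc, .one]
  | .y => [.y, .zc, .xc, .one]
  | .z => [.z, .zc, .yc, .xc, .one]
  | .zc => [.zc, .xc, .one]
  | .yc => [.yc, .one]
  | .xc => [.xc, .one]
  | .one => [.one]

/-- The involution. -/
def inv : PKB8Star → PKB8Star
  | .zero => .one
  | .x => .xc
  | .y => .yc
  | .z => .zc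
  | .zc => .z
  | .yc => .y
  | .xc => .x
  | .one => .zero

instance : PKLattice PKB8Star where
  le a b := b ∈ up a
  le_refl := by decide
  le_trans := by decide
  le_antisymm := by decide
  sup a b := (elems.find? fun c => c ∈ up a ∧ c ∈ up b).getD .one
  le_sup_left := by decide
  le_sup_right := by decide
  sup_le := by decide
  inf a b := (elems.reverse.find? fun c => a ∈ up c ∧ b ∈ up c).getD .zero
  inf_le_left := by decide
  inf_le_right := by decide
  le_inf := by decide
  top := .one
  le_top := by decide
  bot := .zero
  bot_le := by decide
  compl := inv
  compl_antitone := by decide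
  compl_invol := by decide
  kleene := by decide

end PKB8Star

/-- The ten-element lattice whose covers are `0 < y', w, x`; `y' < m`; `w < m, n`; `x < n`;
`m < x', w'`; `n < w', y`; and `x', w', y < 1`. The involution exchanges `m` and `n`.
Here `w = x' ⊓ y`, `w' = x ⊔ y'`, `m = y' ⊔ w = x' ⊓ w'` and `n = x ⊔ w = y ⊓ w'`.
In the constructor names a final `c` stands for the prime. -/
inductive PKB10 : Type
  | zero | x | yc | w | n | m | wc | y | xc | one
  deriving DecidableEq

namespace PKB10

/-- The elements, listed along a linear extension of the order. -/
def elems : List PKB10 := [.zero, .x, .yc, .w, .n, .m, .wc, .y, .xc, .one]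

instance : Fintype PKB10 := ⟨⟨elems, by decide⟩, fun a => by cases a <;> decide⟩

/-- `up a` lists the elements `b` with `a ≤ b`. -/
def up : PKB10 → List PKB10
  | .zero => elems
  | .x => [.x, .n, .wc, .y, .one]
  | .yc => [.yc, .m, .wc, .xc, .one]
  | .w => [.w, .n, .m, .wc, .y, .xc, .one]
  | .n => [.n, .wc, .y, .one]
  | .m => [.m, .wc, .xc, .one]
  | .wc => [.wc, .one]
  | .y => [.y, .one]
  | .xc => [.xc, .one]
  | .one => [.one]

/-- The involution. -/
def inv : PKB10 → PKB10
  | .zero => .one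
  | .x => .xc
  | .yc => .y
  | .w => .wc
  | .n => .m
  | .m => .n
  | .wc => .w
  | .y => .yc
  | .xc => .x
  | .one => .zero

instance : PKLattice PKB10 where
  le a b := b ∈ up a
  le_refl := by decide
  le_trans := by decide
  le_antisymm := by decide
  sup a b := (elems.find? fun c => c ∈ up a ∧ c ∈ up b).getD .one
  le_sup_left := by decide
  le_sup_right := by decide
  sup_le := by decide
  inf a b := (elems.reverse.find? fun c => a ∈ up c ∧ b ∈ up c).getD .zero
  inf_le_left := by decide
  inf_le_right := by decide
  le_inf := by decide
  top := .one
  le_top := by decide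
  bot := .zero
  bot_le := by decide
  compl := inv
  compl_antitone := by decide
  compl_invol := by decide
  kleene := by decide

end PKB10

/-! Both directions rest on producing or excluding small configurations.

Excluding: (SP1) is only a quasi-identity, so quotients could destroy it. Modulo (SP2) it is
equivalent to an identity (`isSPOrthomodular_iff`), hence sp-orthomodularity passes to subalgebras
and homomorphic images, and each of the four finite algebras violates (SP1) or (SP2).

Producing: if (SP1) fails at `x ≤ y`, the two sides of the failed equation generate a copy of `PKB6`
or `PKB8`, according to whether `xᶜ ⊓ y` is `⊥`; `PKB8` maps onto `PKB6`. If (SP2) fails, a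
dichotomy applies. Either some `x`, `r` with `r ≤ xᶜ`, `r ≤ rᶜ`, `x ⊓ xᶜ ≤ r` violate `xᶜ ⊓ (x ⊔ r)
= r`, which gives `PKB8Star`; or this law always holds, and it allows `x ≤ y` to be normalised so
that `x ⊔ xᶜ = y ⊔ yᶜ`, which gives `PKB10`. These two appear only as quotients;
`exists_subalgebra_quo_pkIso` reduces finding them to choosing the least element of each class.

A variety contains the subalgebras and quotients so produced, which gives the last claim. -/

namespace PKLattice

variable {A : Type u} [PKLattice A]

/-! ### Involution laws and the equational form of sp-orthomodularity. -/

theorem compl_le_compl_iff {a b : A} : aᶜ ≤ bᶜ ↔ b ≤ a := by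
  refine ⟨fun h => ?_, compl_antitone b a⟩
  simpa only [compl_invol] using compl_antitone _ _ h

theorem le_compl_comm {a b : A} : a ≤ bᶜ ↔ b ≤ aᶜ := by
  rw [← compl_le_compl_iff, compl_invol]

theorem compl_le_comm {a b : A} : aᶜ ≤ b ↔ bᶜ ≤ a := by
  rw [← compl_le_compl_iff, compl_invol]

theorem compl_bot_eq : (⊥ : A)ᶜ = ⊤ :=
  top_le_iff.mp (le_compl_comm.mp bot_le)

theorem compl_top_eq : (⊤ : A)ᶜ = ⊥ := by
  rw [← compl_bot_eq, compl_invol]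

/-- The orthomodular-like identity that replaces the quasi-identity (SP1) modulo (SP2). -/
def OMIdentity (A : Type u) [PKLattice A] : Prop :=
  ∀ x y : A, x ≤ y → y ⊓ (x ⊔ (xᶜ ⊓ y) ⊔ (xᶜ ⊓ (x ⊔ yᶜ))) = x ⊔ (xᶜ ⊓ y)

/-- The identity (SP2). -/
def MeetIdentity (A : Type u) [PKLattice A] : Prop :=
  ∀ x y : A, x ≤ y → (x ⊓ xᶜ) ⊔ (y ⊓ yᶜ) = (xᶜ ⊓ y) ⊓ (xᶜ ⊓ y)ᶜ

theorem sup_le_inf_compl {x y : A} (h : x ≤ y) :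
    (x ⊓ xᶜ) ⊔ (y ⊓ yᶜ) ≤ (xᶜ ⊓ y) ⊓ (xᶜ ⊓ y)ᶜ := by
  have h' := compl_antitone _ _ h
  rw [compl_inf_eq, compl_invol]
  refine sup_le (le_inf (le_inf inf_le_right (inf_le_left.trans h))
    (inf_le_left.trans le_sup_left)) (le_inf (le_inf (inf_le_right.trans h') inf_le_left)
    (inf_le_right.trans le_sup_right))

/-- For `x ≤ y` put `z = x ⊔ (xᶜ ⊓ y)`. Given (SP2), the pair `z ≤ y` always meets the premise of
(SP1), and the conclusion of (SP1) for that pair is the identity. -/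
theorem isSPOrthomodular_iff : IsSPOrthomodular A ↔ MeetIdentity A ∧ OMIdentity A := by
  constructor
  · intro h
    refine ⟨h.sp2, fun x y hxy => ?_⟩
    have hzy : x ⊔ (xᶜ ⊓ y) ≤ y := sup_le hxy inf_le_right
    have hyy : y ⊓ yᶜ ≤ x ⊔ (xᶜ ⊓ y) :=
      le_trans (le_inf (inf_le_right.trans (compl_antitone _ _ hxy)) inf_le_left) le_sup_right
    have e : (x ⊔ (xᶜ ⊓ y))ᶜ = xᶜ ⊓ (x ⊔ yᶜ) := by
      rw [compl_sup_eq, compl_inf_eq, compl_invol]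
    -- `zᶜ ⊓ y ≤ xᶜ ⊓ y ≤ z ≤ (zᶜ ⊓ y)ᶜ`, so the right side of (SP2) for `z ≤ y` is just `zᶜ ⊓ y`.
    have hle : (x ⊔ (xᶜ ⊓ y))ᶜ ⊓ y ≤ ((x ⊔ (xᶜ ⊓ y))ᶜ ⊓ y)ᶜ := by
      rw [compl_inf_eq, compl_invol, e]
      exact le_trans (le_inf (inf_le_left.trans inf_le_left) inf_le_right)
        (le_sup_right.trans le_sup_left)
    have h1 := h.sp1 _ y hzy (by rw [h.sp2 _ y hzy, inf_eq_left.mpr hle])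
    rwa [e, sup_eq_left.mpr hyy] at h1
  · rintro ⟨h2, h1⟩
    refine ⟨fun x y hxy hw => ?_, h2⟩
    have e1 : x ⊔ (xᶜ ⊓ y) = x ⊔ (y ⊓ yᶜ) := by
      rw [hw, ← sup_assoc, sup_inf_self]
    -- The complement of the premise `hw`; it places `y ⊓ (x ⊔ xᶜ)` below `x ⊔ yᶜ`.
    have e2 : x ⊔ yᶜ = (x ⊔ xᶜ) ⊓ (y ⊔ yᶜ) := by
      have := congrArg (fun a => aᶜ) hw
      simp only [compl_sup_eq, compl_inf_eq, compl_invol] at this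
      rw [this, sup_comm xᶜ x, sup_comm yᶜ y]
    apply le_antisymm
    · rw [← e1, ← h1 x y hxy]
      refine le_inf inf_le_left ?_
      have : y ⊓ (x ⊔ xᶜ) ≤ x ⊔ yᶜ := by
        rw [e2]; exact le_inf inf_le_right (inf_le_left.trans le_sup_left)
      refine this.trans (sup_le (le_sup_left.trans le_sup_left) (le_trans ?_ le_sup_right))
      exact le_inf (compl_antitone _ _ hxy) le_sup_right
    · exact sup_le (le_inf hxy le_sup_left) (le_inf inf_le_left (kleene y x))

end PKLattice

open PKLattice

/-! ### Homomorphisms, kernels and preservation of sp-orthomodularity. -/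

section Homs

variable {A : Type u} {B : Type v} [PKLattice A] [PKLattice B]

theorem PKIso.exists_isPKHom (h : PKIso A B) :
    ∃ f : A → B, IsPKHom f ∧ Function.Bijective f := by
  obtain ⟨e, he⟩ := h
  exact ⟨e, ⟨map_inf e, map_sup e, he, map_bot e, map_top e⟩, e.bijective⟩

theorem PKIso.symm (h : PKIso A B) : PKIso B A := by
  obtain ⟨e, he⟩ := h
  exact ⟨e.symm, fun b => by rw [e.symm_apply_eq, he, e.apply_symm_apply]⟩

theorem IsPKHom.comp {C : Type*} [PKLattice C] {g : B → C} {f : A → B}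
    (hg : IsPKHom g) (hf : IsPKHom f) : IsPKHom (g ∘ f) where
  map_inf a b := by simp [hf.map_inf, hg.map_inf]
  map_sup a b := by simp [hf.map_sup, hg.map_sup]
  map_compl a := by simp [hf.map_compl, hg.map_compl]
  map_bot := by simp [hf.map_bot, hg.map_bot]
  map_top := by simp [hf.map_top, hg.map_top]

/-- A map preserving joins, complements and the bottom element is a homomorphism. -/
theorem IsPKHom.of_sup_compl {f : A → B} (hs : ∀ a b, f (a ⊔ b) = f a ⊔ f b)
    (hc : ∀ a, f aᶜ = (f a)ᶜ) (hb : f ⊥ = ⊥) : IsPKHom f where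
  map_inf a b := by
    rw [← compl_invol (a ⊓ b), hc, compl_inf_eq, hs, hc, hc, ← compl_inf_eq, compl_invol]
  map_sup := hs
  map_compl := hc
  map_bot := hb
  map_top := by rw [← compl_bot_eq, hc, hb, compl_bot_eq]

theorem IsSPOrthomodular.of_injective {f : A → B} (hf : IsPKHom f) (hi : Function.Injective f)
    (h : IsSPOrthomodular B) : IsSPOrthomodular A := by
  have mono : ∀ a b, a ≤ b → f a ≤ f b := fun a b hab => by
    rw [← sup_eq_right.mpr hab, hf.map_sup]; exact le_sup_left
  constructor
  · intro x y hxy hw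
    apply hi
    have := h.sp1 (f x) (f y) (mono _ _ hxy)
    simp only [← hf.map_compl, ← hf.map_inf, ← hf.map_sup] at this
    exact this (congrArg f hw)
  · intro x y hxy
    apply hi
    have := h.sp2 (f x) (f y) (mono _ _ hxy)
    simpa only [← hf.map_compl, ← hf.map_inf, ← hf.map_sup] using this

/-- Identities pass to images. The side condition `x ≤ y` is harmless: preimages `a`, `b` can be
replaced by `a ⊓ b ≤ b`. -/
theorem IsSPOrthomodular.of_surjective {f : A → B} (hf : IsPKHom f) (hs : Function.Surjective f)
    (h : IsSPOrthomodular A) : IsSPOrthomodular B := by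
  rw [isSPOrthomodular_iff] at h ⊢
  obtain ⟨h2, h1⟩ := h
  have lift : ∀ x y : B, x ≤ y → ∃ a b, a ≤ b ∧ f a = x ∧ f b = y := by
    intro x y hxy
    obtain ⟨a, rfl⟩ := hs x
    obtain ⟨b, rfl⟩ := hs y
    exact ⟨a ⊓ b, b, inf_le_right, by rw [hf.map_inf, inf_eq_left.mpr hxy], rfl⟩
  constructor
  · intro x y hxy
    obtain ⟨a, b, hab, rfl, rfl⟩ := lift x y hxy
    simpa only [hf.map_compl, hf.map_inf, hf.map_sup] using congrArg f (h2 a b hab)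
  · intro x y hxy
    obtain ⟨a, b, hab, rfl, rfl⟩ := lift x y hxy
    simpa only [hf.map_compl, hf.map_inf, hf.map_sup] using congrArg f (h1 a b hab)

theorem PKSubalgebra.isPKHom_val (S : PKSubalgebra A) : IsPKHom (Subtype.val : S → A) where
  map_inf _ _ := rfl
  map_sup _ _ := rfl
  map_compl _ := rfl
  map_bot := rfl
  map_top := rfl

theorem PKCon.isPKHom_toQuo (θ : PKCon A) : IsPKHom θ.toQuo where
  map_inf _ _ := rfl
  map_sup _ _ := rfl
  map_compl _ := rfl
  map_bot := rfl
  map_top := rfl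

theorem PKCon.toQuo_surjective (θ : PKCon A) : Function.Surjective θ.toQuo :=
  Quotient.mk_surjective

theorem IsSPOrthomodular.of_pkIso (h : IsSPOrthomodular A) (e : PKIso A B) :
    IsSPOrthomodular B := by
  obtain ⟨f, hf, hb⟩ := e.exists_isPKHom
  exact h.of_surjective hf hb.surjective

theorem IsSPOrthomodular.subalgebra (h : IsSPOrthomodular A) (S : PKSubalgebra A) :
    IsSPOrthomodular S :=
  IsSPOrthomodular.of_injective S.isPKHom_val Subtype.val_injective h

theorem IsSPOrthomodular.quo (h : IsSPOrthomodular A) (θ : PKCon A) : IsSPOrthomodular θ.Quo :=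
  h.of_surjective θ.isPKHom_toQuo θ.toQuo_surjective

/-- The kernel of a homomorphism. -/
def IsPKHom.ker {f : A → B} (hf : IsPKHom f) : PKCon A where
  r a b := f a = f b
  iseqv := ⟨fun _ => rfl, Eq.symm, Eq.trans⟩
  inf h k := by
    exact (hf.map_inf _ _).trans ((congrArg₂ _ h k).trans (hf.map_inf _ _).symm)
  sup h k := by
    exact (hf.map_sup _ _).trans ((congrArg₂ _ h k).trans (hf.map_sup _ _).symm)
  compl h := by
    exact (hf.map_compl _).trans ((congrArg _ h).trans (hf.map_compl _).symm)

theorem IsPKHom.pkIso_of_bijective {f : A → B} (hf : IsPKHom f) (hb : Function.Bijective f) :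
    PKIso A B := by
  refine ⟨⟨Equiv.ofBijective f hb, ?_⟩, hf.map_compl⟩
  intro a b
  change f a ≤ f b ↔ a ≤ b
  rw [← sup_eq_right, ← hf.map_sup, hb.injective.eq_iff, sup_eq_right]

/-- The homomorphism theorem. -/
theorem IsPKHom.pkIso_quo_ker {f : A → B} (hf : IsPKHom f) (hs : Function.Surjective f) :
    PKIso hf.ker.Quo B := by
  let g : hf.ker.Quo → B := Quotient.lift f fun _ _ h => h
  have hg : IsPKHom g := by
    constructor
    · rintro ⟨a⟩ ⟨b⟩; exact hf.map_inf a b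
    · rintro ⟨a⟩ ⟨b⟩; exact hf.map_sup a b
    · rintro ⟨a⟩; exact hf.map_compl a
    · exact hf.map_bot
    · exact hf.map_top
  refine hg.pkIso_of_bijective ⟨?_, fun b => ?_⟩
  · rintro ⟨a⟩ ⟨b⟩ h; exact Quotient.sound h
  · obtain ⟨a, rfl⟩ := hs b
    exact ⟨hf.ker.toQuo a, rfl⟩

theorem PKIso.exists_quo {C : Type*} [PKLattice C] (e : PKIso A B) {f : B → C} (hf : IsPKHom f)
    (hs : Function.Surjective f) : ∃ θ : PKCon A, PKIso θ.Quo C := by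
  obtain ⟨g, hg, hb⟩ := e.exists_isPKHom
  exact ⟨_, (hf.comp hg).pkIso_quo_ker (hs.comp hb.surjective)⟩

end Homs

/-! ### Recognising a finite algebra as a subalgebra or as a quotient of one. -/

section Embedding

variable {A : Type u} {Q : Type v} [PKLattice A] [PKLattice Q]

/-- If an order-reflecting join-homomorphism preserves complements, its range is a subalgebra
isomorphic to its domain. -/
theorem exists_subalgebra_pkIso {f : Q → A} (hs : ∀ p q, f (p ⊔ q) = f p ⊔ f q)
    (hc : ∀ p, f pᶜ = (f p)ᶜ) (hb : f ⊥ = ⊥) (hr : ∀ p q, f p ≤ f q → p ≤ q) :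
    ∃ B : PKSubalgebra A, PKIso B Q := by
  have hf := IsPKHom.of_sup_compl hs hc hb
  obtain ⟨S, hS⟩ : ∃ S : PKSubalgebra A, (S.carrier : Set A) = Set.range f := ⟨
    { carrier := Set.range f
      supClosed' := by
        rintro _ ⟨p, rfl⟩ _ ⟨q, rfl⟩; exact ⟨p ⊔ q, hs p q⟩
      infClosed' := by
        rintro _ ⟨p, rfl⟩ _ ⟨q, rfl⟩; exact ⟨p ⊓ q, hf.map_inf p q⟩
      bot_mem' := ⟨⊥, hb⟩
      top_mem' := ⟨⊤, hf.map_top⟩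
      compl_mem' := by rintro _ ⟨p, rfl⟩; exact ⟨pᶜ, hc p⟩ }, rfl⟩
  refine ⟨S, PKIso.symm ?_⟩
  have hfS : ∀ q, f q ∈ S.carrier := fun q => hS ▸ ⟨q, rfl⟩
  let g : Q → S := fun q => ⟨f q, hfS q⟩
  have hg : IsPKHom g :=
    ⟨fun a b => Subtype.ext (hf.map_inf a b), fun a b => Subtype.ext (hs a b),
      fun a => Subtype.ext (hc a), Subtype.ext hb, Subtype.ext hf.map_top⟩
  refine hg.pkIso_of_bijective ⟨fun p q h => ?_, ?_⟩
  · have h' : f p = f q := congrArg Subtype.val h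
    exact le_antisymm (hr _ _ h'.le) (hr _ _ h'.ge)
  · rintro ⟨a, ha⟩
    obtain ⟨q, rfl⟩ : a ∈ Set.range f := hS ▸ ha
    exact ⟨q, rfl⟩

/-- A join-homomorphism `β : Q → A` such that `β p` is orthogonal to `β q` exactly when `p` is
orthogonal to `q` exhibits `Q` as a quotient of the subalgebra of `A` that is the union of the
(pairwise disjoint) intervals from `β q` to `(β qᶜ)ᶜ`. -/
theorem exists_subalgebra_quo_pkIso {β : Q → A} (hs : ∀ p q, β (p ⊔ q) = β p ⊔ β q)
    (hb : β ⊥ = ⊥) (ho : ∀ p q, β p ≤ (β q)ᶜ ↔ p ≤ qᶜ) :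
    ∃ (B : PKSubalgebra A) (θ : PKCon B), PKIso θ.Quo Q := by
  have mono : ∀ p q, p ≤ q → β p ≤ β q := fun p q h => by
    rw [← sup_eq_right.mpr h, hs]; exact le_sup_left
  let R : A → Q → Prop := fun a q => β q ≤ a ∧ a ≤ (β qᶜ)ᶜ
  -- From `β p ≤ a ≤ b ≤ (β qᶜ)ᶜ`, orthogonality of `β p` and `β qᶜ` reflects to `p ≤ q`; hence the
  -- intervals are disjoint.
  have le_of : ∀ a b p q, R a p → R b q → a ≤ b → p ≤ q := by
    rintro a b p q ⟨h1, -⟩ ⟨-, h2⟩ h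
    have := (ho p qᶜ).mp (h1.trans (h.trans h2))
    rwa [compl_invol] at this
  have uniq : ∀ a p q, R a p → R a q → p = q := fun a p q h k =>
    le_antisymm (le_of _ _ _ _ h k le_rfl) (le_of _ _ _ _ k h le_rfl)
  have hRc : ∀ a q, R a q → R aᶜ qᶜ := by
    rintro a q ⟨h1, h2⟩
    refine ⟨le_compl_comm.mp h2, ?_⟩
    rw [compl_invol]; exact compl_antitone _ _ h1
  have hRs : ∀ a b p q, R a p → R b q → R (a ⊔ b) (p ⊔ q) := by
    rintro a b p q ⟨h1, h2⟩ ⟨h3, h4⟩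
    refine ⟨(hs p q).le.trans (sup_le_sup h1 h3), sup_le (h2.trans ?_) (h4.trans ?_)⟩
    · exact compl_antitone _ _ (mono _ _ (compl_antitone _ _ le_sup_left))
    · exact compl_antitone _ _ (mono _ _ (compl_antitone _ _ le_sup_right))
  have hRi : ∀ a b p q, R a p → R b q → R (a ⊓ b) (p ⊓ q) := by
    intro a b p q h k
    have := hRc _ _ (hRs _ _ _ _ (hRc _ _ h) (hRc _ _ k))
    simpa only [compl_sup_eq, compl_invol] using this
  have hRb : R ⊥ ⊥ := ⟨hb.le, bot_le⟩
  have hRt : R ⊤ ⊤ := by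
    have := hRc _ _ hRb
    rwa [compl_bot_eq, compl_bot_eq] at this
  obtain ⟨S, hS⟩ : ∃ S : PKSubalgebra A, ∀ a, a ∈ S.carrier ↔ ∃ q, R a q := ⟨
    { carrier := {a | ∃ q, R a q}
      supClosed' := by
        rintro _ ⟨p, hp⟩ _ ⟨q, hq⟩; exact ⟨p ⊔ q, hRs _ _ _ _ hp hq⟩
      infClosed' := by
        rintro _ ⟨p, hp⟩ _ ⟨q, hq⟩; exact ⟨p ⊓ q, hRi _ _ _ _ hp hq⟩
      bot_mem' := ⟨⊥, hRb⟩
      top_mem' := ⟨⊤, hRt⟩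
      compl_mem' := by rintro _ ⟨p, hp⟩; exact ⟨pᶜ, hRc _ _ hp⟩ }, fun _ => Iff.rfl⟩
  choose f hf using fun a : S => (hS a).mp a.2
  have hom : IsPKHom f := by
    constructor
    · exact fun a b => uniq _ _ _ (hf (a ⊓ b)) (hRi _ _ _ _ (hf a) (hf b))
    · exact fun a b => uniq _ _ _ (hf (a ⊔ b)) (hRs _ _ _ _ (hf a) (hf b))
    · exact fun a => uniq _ _ _ (hf aᶜ) (hRc _ _ (hf a))
    · exact uniq _ _ _ (hf ⊥) hRb
    · exact uniq _ _ _ (hf ⊤) hRt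
  refine ⟨S, hom.ker, hom.pkIso_quo_ker fun q => ?_⟩
  -- Since `q` is orthogonal to `qᶜ`, no interval is empty, so `f` is onto.
  have hq : R (β q) q := ⟨le_rfl, (ho q qᶜ).mpr (compl_invol q).ge⟩
  exact ⟨⟨β q, (hS _).mpr ⟨q, hq⟩⟩, uniq _ _ _ (hf _) hq⟩

end Embedding

/-! ### The four finite algebras are not sp-orthomodular. -/

instance : DecidableLE PKB6 := fun a b => inferInstanceAs (Decidable (b ∈ PKB6.up a))

instance : DecidableLE PKB8 := fun a b => inferInstanceAs (Decidable (b ∈ PKB8.up a))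

instance : DecidableLE PKB8Star := fun a b => inferInstanceAs (Decidable (b ∈ PKB8Star.up a))

instance : DecidableLE PKB10 := fun a b => inferInstanceAs (Decidable (b ∈ PKB10.up a))

theorem not_isSPOrthomodular_PKB6 : ¬ IsSPOrthomodular PKB6 := fun h =>
  absurd (h.sp1 .x .y) (by decide)

theorem not_isSPOrthomodular_PKB8 : ¬ IsSPOrthomodular PKB8 := fun h =>
  absurd (h.sp1 .x .y) (by decide)

theorem not_isSPOrthomodular_PKB8Star : ¬ IsSPOrthomodular PKB8Star := fun h =>
  absurd (h.sp2 .y .xc) (by decide)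

theorem not_isSPOrthomodular_PKB10 : ¬ IsSPOrthomodular PKB10 := fun h =>
  absurd (h.sp2 .x .y) (by decide)

/-- The homomorphism identifying `0` with `z'` and `z` with `1`. -/
def PKB8.toPKB6 : PKB8 → PKB6
  | .zero => .zero
  | .zc => .zero
  | .x => .x
  | .yc => .yc
  | .y => .y
  | .xc => .xc
  | .z => .one
  | .one => .one

theorem PKB8.isPKHom_toPKB6 : IsPKHom PKB8.toPKB6 :=
  ⟨by decide, by decide, by decide, by decide, by decide⟩

theorem PKB8.toPKB6_surjective : Function.Surjective PKB8.toPKB6 := by decide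

/-! ### Configurations of elements that force the four algebras. -/

section Configurations

variable {A : Type u} [PKLattice A]

/-- The map that spans a copy of `PKB6` by `a` and `b`. -/
def b6Map (a b : A) : PKB6 → A
  | .zero => ⊥
  | .x => a
  | .yc => bᶜ
  | .y => b
  | .xc => aᶜ
  | .one => ⊤

/-- The map that spans a copy of `PKB8` by `a`, `b` and `w`. -/
def b8Map (a b w : A) : PKB8 → A
  | .zero => ⊥
  | .zc => w
  | .x => a
  | .yc => bᶜ
  | .y => b
  | .xc => aᶜ
  | .z => wᶜ
  | .one => ⊤

/-- The least elements of the classes of a quotient isomorphic to `PKB8Star`. -/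
def b8StarMap (x r t : A) : PKB8Star → A
  | .zero => ⊥
  | .x => r
  | .y => x
  | .z => t
  | .zc => x ⊔ r
  | .yc => xᶜ
  | .xc => rᶜ
  | .one => x ⊔ xᶜ

/-- The least elements of the classes of a quotient isomorphic to `PKB10`. -/
def b10Map (x y t : A) : PKB10 → A
  | .zero => ⊥
  | .x => x
  | .yc => yᶜ
  | .w => t
  | .n => x ⊔ t
  | .m => yᶜ ⊔ t
  | .wc => x ⊔ yᶜ
  | .y => y
  | .xc => xᶜ
  | .one => x ⊔ xᶜ

set_option maxHeartbeats 2000000 in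
theorem exists_PKB6_or_PKB8 {a b w : A} (hab : a < b) (hw : aᶜ ⊓ b = w) (hwa : w ≤ a)
    (hbw : b ≤ wᶜ) : ∃ B : PKSubalgebra A, PKIso B PKB6 ∨ PKIso B PKB8 := by
  have hw' : a ⊔ bᶜ = wᶜ := by rw [← hw, compl_inf_eq, compl_invol]
  have hba : bᶜ ≤ aᶜ := compl_antitone _ _ hab.le
  have haw : aᶜ ≤ wᶜ := compl_antitone _ _ hwa
  have hwb : w ≤ bᶜ := PKLattice.le_compl_comm.mp hbw
  have n1 : ¬ b ≤ a := not_le_of_gt hab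
  have n2 : ¬ aᶜ ≤ bᶜ := fun h => n1 (compl_le_compl_iff.mp h)
  have n3 : ¬ a ≤ aᶜ := fun h => by
    have h1 : a ≤ w := hw ▸ le_inf h hab.le
    have h2 : a = w := le_antisymm h1 hwa
    have h3 : b ≤ w := hw ▸ le_inf (h2 ▸ hbw) le_rfl
    exact n1 (h3.trans hwa)
  have n4 : ¬ bᶜ ≤ b := fun h => by
    have h1 : bᶜ ≤ w := hw ▸ le_inf hba h
    have h2 : wᶜ ≤ b := PKLattice.compl_le_comm.mp h1
    have h3 : aᶜ ≤ w := hw ▸ le_inf le_rfl (haw.trans h2)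
    exact n2 (h3.trans hwb)
  by_cases h0 : w = ⊥
  · have h1 : wᶜ = ⊤ := by rw [h0, compl_bot_eq]
    refine (exists_subalgebra_pkIso (f := b6Map a b) ?_ ?_ rfl ?_).imp fun _ => Or.inl
    · intro p q
      -- Naming the join lets `decide` discard every wrong value of `r`; what remains is one lattice
      -- equation per entry of the join table.
      generalize hr : p ⊔ q = r
      cases p <;> cases q <;> cases r <;>
        first
        | exact absurd hr (by decide)
        | (clear hr; simp only [b6Map]; order)
    · intro p
      cases p <;>
        first | rfl | exact (compl_invol _).symm | exact compl_bot_eq.symm | exact compl_top_eq.symm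
    · intro p q
      cases p <;> cases q <;>
        first
        | exact fun _ => by decide
        | (intro h; exfalso; simp only [b6Map] at h; order)
  · have h0' : ¬ w ≤ ⊥ := fun h => h0 (le_bot_iff.mp h)
    have h1' : ¬ ⊤ ≤ wᶜ := fun h => h0' (by
      rw [← compl_le_compl_iff, compl_bot_eq]; exact h)
    refine (exists_subalgebra_pkIso (f := b8Map a b w) ?_ ?_ rfl ?_).imp fun _ => Or.inr
    · intro p q
      generalize hr : p ⊔ q = r
      cases p <;> cases q <;> cases r <;>
        first
        | exact absurd hr (by decide)
        | (clear hr; simp only [b8Map]; order)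
    · intro p
      cases p <;>
        first | rfl | exact (compl_invol _).symm | exact compl_bot_eq.symm | exact compl_top_eq.symm
    · intro p q
      cases p <;> cases q <;>
        first
        | exact fun _ => by decide
        | (intro h; exfalso; simp only [b8Map] at h; order)

-- The elements `x`, `y`, `z` of `PKB8Star` are played by `r`, `x`, `t`. Since `t` lies between `r`
-- and `x ⊔ r`, it has the same join with `x` as `r` has. The top class starts at `x ⊔ xᶜ`, which
-- may lie below `⊤`; hence a quotient.
set_option maxHeartbeats 2000000 in
theorem exists_quo_PKB8Star {x r t : A} (hxr : r ≤ xᶜ) (hr : r ≤ rᶜ) (hs : x ⊓ xᶜ ≤ r)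
    (hrt : r ≤ t) (htx : t ≤ xᶜ) (ht : t ≤ x ⊔ r) (hn : ¬ t ≤ r) :
    ∃ (B : PKSubalgebra A) (θ : PKCon B), PKIso θ.Quo PKB8Star := by
  have hrx : x ≤ rᶜ := PKLattice.le_compl_comm.mp hxr
  have hs' : rᶜ ≤ x ⊔ xᶜ := by
    have := compl_antitone _ _ hs
    rwa [compl_inf_eq, compl_invol, sup_comm] at this
  have hxt : x ≤ tᶜ := PKLattice.le_compl_comm.mp htx
  have ht' : xᶜ ⊓ rᶜ ≤ tᶜ := by
    rw [← compl_sup_eq]; exact compl_antitone _ _ ht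
  have hrt' : tᶜ ≤ rᶜ := compl_antitone _ _ hrt
  have hsup : ∀ p q, b8StarMap x r t (p ⊔ q) = b8StarMap x r t p ⊔ b8StarMap x r t q := by
    intro p q
    generalize hr : p ⊔ q = r
    cases p <;> cases q <;> cases r <;>
      first
      | exact absurd hr (by decide)
      | (clear hr; simp only [b8StarMap] <;> order)
  have n1 : ¬ x ≤ xᶜ := fun h => by
    have : x ≤ r := (le_inf le_rfl h).trans hs
    exact hn (ht.trans (sup_le this le_rfl))
  have n2 : ¬ r ≤ x := fun h => by
    have : t ≤ x := ht.trans (sup_le le_rfl h)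
    exact hn ((le_inf this htx).trans hs)
  have n3 : ¬ xᶜ ≤ x := fun h => hn (htx.trans ((le_inf h le_rfl).trans hs))
  have n4 : ¬ xᶜ ≤ rᶜ := fun h => n2 (compl_le_compl_iff.mp h)
  have n5 : ¬ rᶜ ≤ tᶜ := fun h => hn (compl_le_compl_iff.mp h)
  have htt : t ≤ tᶜ := ht.trans (sup_le hxt (PKLattice.le_compl_comm.mp (ht.trans (sup_le hrx hr))))
  refine exists_subalgebra_quo_pkIso hsup rfl fun p q => ?_
  cases p <;> cases q <;>
    simp only [b8StarMap, compl_sup_eq, compl_invol, compl_bot_eq] <;>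
      first
      | (refine iff_of_true ?_ (by decide); first | done | exact bot_le | exact le_top | order)
      | (refine iff_of_false ?_ (by decide); order)

-- The equation `x ⊔ xᶜ = y ⊔ yᶜ` gives both complementary pairs the same join, the bottom of the
-- top class; `t` plays `w`, and `¬ t ≤ x` is what keeps the classes apart.
set_option maxHeartbeats 2000000 in
theorem exists_quo_PKB10 {x y t : A} (hxy : x ≤ y) (hu : x ⊔ xᶜ = y ⊔ yᶜ) (hx : t ≤ xᶜ)
    (hy : t ≤ y) (ht : t ≤ x ⊔ yᶜ) (hn : ¬ t ≤ x) :
    ∃ (B : PKSubalgebra A) (θ : PKCon B), PKIso θ.Quo PKB10 := by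
  have hyx : yᶜ ≤ xᶜ := compl_antitone _ _ hxy
  have hu' : x ⊓ xᶜ = y ⊓ yᶜ := by
    have := congrArg (fun a => aᶜ) hu
    simp only [compl_sup_eq, compl_invol] at this
    rw [inf_comm x, inf_comm y, this]
  have hx' : x ≤ tᶜ := PKLattice.le_compl_comm.mp hx
  have hy' : yᶜ ≤ tᶜ := compl_antitone _ _ hy
  have htt : t ≤ tᶜ := ht.trans (sup_le hx' hy')
  have hsup : ∀ p q, b10Map x y t (p ⊔ q) = b10Map x y t p ⊔ b10Map x y t q := by
    intro p q
    generalize hr : p ⊔ q = r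
    cases p <;> cases q <;> cases r <;>
      first
      | exact absurd hr (by decide)
      | (clear hr; simp only [b10Map] <;> order)
  have n1 : ¬ x ≤ xᶜ := fun h => by
    have h1 : x ≤ yᶜ := (le_inf le_rfl h).trans (hu'.le.trans inf_le_right)
    exact hn ((le_inf hy (ht.trans (sup_le h1 le_rfl))).trans (hu'.ge.trans inf_le_left))
  have n2 : ¬ yᶜ ≤ y := fun h => by
    have h1 : yᶜ ≤ x := (le_inf h le_rfl).trans (hu'.ge.trans inf_le_left)
    exact hn (ht.trans (sup_le le_rfl h1))
  have n3 : ¬ xᶜ ≤ y := fun h => n2 (hyx.trans h)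
  have n4 : ¬ t ≤ yᶜ := fun h => hn ((le_inf hy h).trans (hu'.ge.trans inf_le_left))
  have n5 : ¬ xᶜ ≤ tᶜ := fun h => hn (compl_le_compl_iff.mp h)
  have n6 : ¬ y ≤ tᶜ := fun h => n4 (PKLattice.le_compl_comm.mp h)
  have n7 : ¬ xᶜ ≤ x := fun h => n3 (h.trans hxy)
  have n8 : ¬ y ≤ yᶜ := fun h => n1 (hxy.trans (h.trans hyx))
  refine exists_subalgebra_quo_pkIso hsup rfl fun p q => ?_
  cases p <;> cases q <;>
    simp only [b10Map, compl_sup_eq, compl_invol, compl_bot_eq] <;>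
      first
      | (refine iff_of_true ?_ (by decide); first | done | exact bot_le | exact le_top | order)
      | (refine iff_of_false ?_ (by decide); order)

end Configurations

/-! ### From failures of (SP1) and (SP2) to the forbidden configurations. -/

section Main

variable {A : Type u} [PKLattice A]

/-- A failure of (SP1) yields a copy of `PKB6` or of `PKB8`. -/
theorem exists_of_not_sp1 {x y : A} (hxy : x ≤ y) (hw : xᶜ ⊓ y = (x ⊓ xᶜ) ⊔ (y ⊓ yᶜ))
    (hne : y ⊓ (x ⊔ xᶜ) ≠ x ⊔ (y ⊓ yᶜ)) :
    ∃ B : PKSubalgebra A, PKIso B PKB6 ∨ PKIso B PKB8 := by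
  have hle : x ⊔ (y ⊓ yᶜ) ≤ y ⊓ (x ⊔ xᶜ) :=
    sup_le (le_inf hxy le_sup_left) (le_inf inf_le_left (kleene y x))
  have hyy : y ⊓ yᶜ ≤ xᶜ ⊓ y := hw ▸ le_sup_right
  have hw' : (xᶜ ⊓ y)ᶜ = (x ⊔ xᶜ) ⊓ (y ⊔ yᶜ) := by
    rw [hw, compl_sup_eq, compl_inf_eq, compl_inf_eq, compl_invol, compl_invol, sup_comm xᶜ,
      sup_comm yᶜ]
  -- Here `a` and `b` are the two sides of the failed equation, and `aᶜ ⊓ b` is still `xᶜ ⊓ y`.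
  refine exists_PKB6_or_PKB8 (lt_of_le_of_ne hle hne.symm) (w := xᶜ ⊓ y) ?_ ?_ ?_
  · rw [compl_sup_eq, compl_inf_eq, compl_invol]
    apply le_antisymm
    · exact le_inf (inf_le_left.trans inf_le_left) (inf_le_right.trans inf_le_left)
    · refine le_inf (le_inf inf_le_left (inf_le_right.trans le_sup_right))
        (le_inf inf_le_right (inf_le_left.trans le_sup_right))
  · rw [hw]; exact sup_le_sup inf_le_left le_rfl
  · rw [hw']; exact le_inf inf_le_right (inf_le_left.trans le_sup_left)

/-- A failure of (SP2) yields a subalgebra with a quotient `PKB8Star` or `PKB10`. -/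
theorem exists_of_not_sp2 {x y : A} (hxy : x ≤ y)
    (hne : (x ⊓ xᶜ) ⊔ (y ⊓ yᶜ) ≠ (xᶜ ⊓ y) ⊓ (xᶜ ⊓ y)ᶜ) :
    ∃ (B : PKSubalgebra A) (θ : PKCon B), PKIso θ.Quo PKB8Star ∨ PKIso θ.Quo PKB10 := by
  -- A violation of this law is exactly a `PKB8Star` configuration with `t = xᶜ ⊓ (x ⊔ r)`.
  by_cases hP : ∀ x r : A, r ≤ xᶜ → r ≤ rᶜ → x ⊓ xᶜ ≤ r → xᶜ ⊓ (x ⊔ r) ≤ r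
  swap
  · push Not at hP
    obtain ⟨x, r, h1, h2, h3, h4⟩ := hP
    obtain ⟨B, θ, h⟩ := exists_quo_PKB8Star (t := xᶜ ⊓ (x ⊔ r)) h1 h2 h3 (le_inf h1 le_sup_right)
      inf_le_left inf_le_right h4
    exact ⟨B, θ, Or.inl h⟩
  have hyx := compl_antitone _ _ hxy
  have hlt := lt_of_le_of_ne (sup_le_inf_compl hxy) hne
  obtain ⟨u, hu⟩ : ∃ u, u = (x ⊓ xᶜ) ⊔ (y ⊓ yᶜ) := ⟨_, rfl⟩
  rw [← hu, compl_inf_eq, compl_invol] at hlt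
  have hxu : x ⊓ xᶜ ≤ u := hu ▸ le_sup_left
  have hyu : y ⊓ yᶜ ≤ u := hu ▸ le_sup_right
  have hux : u ≤ xᶜ := hlt.le.trans (inf_le_left.trans inf_le_left)
  have huy : u ≤ y := hlt.le.trans (inf_le_left.trans inf_le_right)
  have huu : u ≤ uᶜ := by
    have h := hlt.le.trans inf_le_right
    exact h.trans (sup_le (PKLattice.le_compl_comm.mp hux) (compl_antitone _ _ huy))
  have hxu' : x ≤ uᶜ := PKLattice.le_compl_comm.mp hux
  have hyu' : yᶜ ≤ uᶜ := compl_antitone _ _ huy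
  -- The law is applied to `x` and to `yᶜ`, both with `r = u`; the complemented forms make both
  -- joins below collapse to `uᶜ ⊔ u`.
  have e1 : xᶜ ⊓ (x ⊔ u) = u := le_antisymm (hP x u hux huu hxu) (le_inf hux le_sup_right)
  have e2 : y ⊓ (yᶜ ⊔ u) = u := by
    have h := hP yᶜ u (by rwa [compl_invol]) huu (by rwa [compl_invol, inf_comm])
    rw [compl_invol] at h
    exact le_antisymm h (le_inf huy le_sup_right)
  have e1' : x ⊔ (xᶜ ⊓ uᶜ) = uᶜ := by
    have := congrArg (fun a => aᶜ) e1
    simpa only [compl_sup_eq, compl_inf_eq, compl_invol] using this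
  have e2' : yᶜ ⊔ (y ⊓ uᶜ) = uᶜ := by
    have := congrArg (fun a => aᶜ) e2
    simpa only [compl_sup_eq, compl_inf_eq, compl_invol] using this
  have ht : xᶜ ⊓ y ⊓ (x ⊔ yᶜ) ≤ uᶜ :=
    inf_le_right.trans (sup_le hxu' hyu')
  -- The pair is squeezed into `x ⊔ u ≤ y ⊓ uᶜ`, and `t` is the right side of (SP2). If `t ≤ x ⊔ u`,
  -- then `t ≤ xᶜ ⊓ (x ⊔ u) = u`, against `u < t`.
  obtain ⟨B, θ, h⟩ := exists_quo_PKB10 (x := x ⊔ u) (y := y ⊓ uᶜ) (t := xᶜ ⊓ y ⊓ (x ⊔ yᶜ))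
    (le_inf (sup_le hxy huy) (sup_le hxu' huu))
    (by
      rw [compl_sup_eq, compl_inf_eq, compl_invol, sup_right_comm, e1', ← sup_assoc,
        sup_comm _ yᶜ, e2'])
    (by
      rw [compl_sup_eq]
      exact le_inf (inf_le_left.trans inf_le_left) ht)
    (le_inf (inf_le_left.trans inf_le_right) ht)
    (by
      rw [compl_inf_eq, compl_invol]
      exact inf_le_right.trans (sup_le_sup le_sup_left le_sup_left))
    (fun h => not_le_of_gt hlt
      (e1 ▸ le_inf (inf_le_left.trans inf_le_left) h))
  exact ⟨B, θ, Or.inr h⟩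

theorem exists_of_not_isSPOrthomodular (h : ¬ IsSPOrthomodular A) :
    ∃ B : PKSubalgebra A, PKIso B PKB6 ∨ PKIso B PKB8 ∨
      ∃ θ : PKCon B, PKIso θ.Quo PKB8Star ∨ PKIso θ.Quo PKB10 := by
  by_contra hno
  refine h ⟨fun x y hxy hw => ?_, fun x y hxy => ?_⟩
  · by_contra hne
    obtain ⟨B, hB⟩ := exists_of_not_sp1 hxy hw hne
    exact hno ⟨B, hB.imp_right Or.inl⟩
  · by_contra hne
    obtain ⟨B, hB⟩ := exists_of_not_sp2 hxy hne
    exact hno ⟨B, Or.inr (Or.inr hB)⟩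

theorem exists_quo_of_not_isSPOrthomodular (h : ¬ IsSPOrthomodular A) :
    ∃ (B : PKSubalgebra A) (θ : PKCon B),
      PKIso θ.Quo PKB6 ∨ PKIso θ.Quo PKB8Star ∨ PKIso θ.Quo PKB10 := by
  obtain ⟨B, hB | hB | ⟨θ, hθ⟩⟩ := exists_of_not_isSPOrthomodular h
  · obtain ⟨θ, hθ⟩ := hB.exists_quo (f := id)
      ⟨fun _ _ => rfl, fun _ _ => rfl, fun _ => rfl, rfl, rfl⟩ Function.surjective_id
    exact ⟨B, θ, Or.inl hθ⟩
  · obtain ⟨θ, hθ⟩ := hB.exists_quo PKB8.isPKHom_toPKB6 PKB8.toPKB6_surjective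
    exact ⟨B, θ, Or.inl hθ⟩
  · exact ⟨B, θ, Or.inr hθ⟩

theorem IsSPOrthomodular.not_pkIso (h : IsSPOrthomodular A) :
    ¬ (PKIso A PKB6 ∨ PKIso A PKB8Star ∨ PKIso A PKB10) := by
  rintro (e | e | e)
  · exact not_isSPOrthomodular_PKB6 (h.of_pkIso e)
  · exact not_isSPOrthomodular_PKB8Star (h.of_pkIso e)
  · exact not_isSPOrthomodular_PKB10 (h.of_pkIso e)

end Main

theorem mainTheorem5 :
    (∀ (A : Type u) [PKLattice A],
      IsSPOrthomodular A ↔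
        ¬ ∃ B : PKSubalgebra A,
          PKIso B PKB6 ∨ PKIso B PKB8 ∨
            ∃ θ : PKCon B, PKIso θ.Quo PKB8Star ∨ PKIso θ.Quo PKB10) ∧
    (∀ (A : Type u) [PKLattice A],
      IsSPOrthomodular A ↔
        ¬ ∃ (B : PKSubalgebra A) (θ : PKCon B),
          PKIso θ.Quo PKB6 ∨ PKIso θ.Quo PKB8Star ∨ PKIso θ.Quo PKB10) ∧
    (∀ V : (∀ A : Type u, PKLattice A → Prop), IsPKVariety V →
      ((∀ (A : Type u) [iA : PKLattice A], V A iA → IsSPOrthomodular A) ↔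
        ¬ ∃ (A : Type u) (iA : PKLattice A), V A iA ∧
          (PKIso A PKB6 ∨ PKIso A PKB8Star ∨ PKIso A PKB10))) := by
  refine ⟨fun A _ => ⟨?_, fun h => ?_⟩, fun A _ => ⟨?_, fun h => ?_⟩, fun V hV => ⟨?_, ?_⟩⟩
  · rintro h ⟨B, e | e | ⟨θ, e⟩⟩
    · exact (h.subalgebra B).not_pkIso (Or.inl e)
    · exact not_isSPOrthomodular_PKB8 ((h.subalgebra B).of_pkIso e)
    · exact ((h.subalgebra B).quo θ).not_pkIso (Or.inr e)
  · by_contra hA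
    exact h (exists_of_not_isSPOrthomodular hA)
  · rintro h ⟨B, θ, e⟩
    exact ((h.subalgebra B).quo θ).not_pkIso e
  · by_contra hA
    exact h (exists_quo_of_not_isSPOrthomodular hA)
  · rintro h ⟨A, iA, hA, e⟩
    exact (h A hA).not_pkIso e
  · intro h A iA hA
    by_contra hn
    obtain ⟨B, θ, e⟩ := exists_quo_of_not_isSPOrthomodular hn
    exact h ⟨θ.Quo, inferInstance, hV.hom_image B θ.Quo θ.toQuo θ.isPKHom_toQuo
      θ.toQuo_surjective (hV.subalgebra A B hA), e⟩
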